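/- Let $Y=[0,2\pi)^d$ and let $A=(a_{jk})_{j,k=1}^d$ be a matrix of real, bounded, measurable functions on $\mathbb{R}^d$ which is symmetric, $Y$-periodic ($A(y+2\pi p)=A(y)$ for all $p\in\mathbb{Z}^d$ and a.e. $y$), and elliptic: there is $\alpha>0$ with $A(y)\xi\cdot\xi\ge\alpha|\xi|^2$ for all $\xi\in\mathbb{R}^d$ and a.e. $y$. Let $H^2_\sharp(Y)$ be the space of $Y$-periodic functions $u\in L^2(Y)$ with $\sum_{n\in\mathbb{Z}^d}(1+|n|^2)^2|\hat u(n)|^2<\infty$. For $\rho>0$ and $\eta\in\mathbb{R}^d$, a real number $\lambda$ is a Bloch eigenvalue if there is a nonzero $\phi\in H^2_\sharp(Y)$ solving $$\rho^2(\nabla+i\eta)^4\phi-(\nabla+i\eta)\cdot A(y)(\nabla+i\eta)\phi=\lambda\phi$$ in the weak sense, that is, for all $v\in H^2_\sharp(Y)$, $$\int_Y A(\nabla+i\eta)\phi\cdot\overline{(\nabla+i\eta)v}\,dy+\rho^2\int_Y(\nabla+i\eta)^2\phi\,\overline{(\nabla+i\eta)^2v}\,dy=\lambda\int_Y\phi\,\overline{v}\,dy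 .$$ **Theorem 4.4.** There is $\delta>0$, independent of $\rho$, such that for every $\rho>0$ the following holds: for each $\eta$ in the ball $B_\delta(0)=\{\eta\in\mathbb{R}^d:|\eta|<\delta\}$ there is a smallest Bloch eigenvalue $\lambda_1^\rho(\eta)$ (the first Bloch eigenvalue), and the function $\eta\mapsto\lambda_1^\rho(\eta)$ is (real-)analytic on $B_\delta(0)$. -/

import Mathlib

namespace BlochWave

open MeasureTheory

/-- The normalized Haar measure of the torus `𝕋^d = ℝ^d / (2πℤ)^d`. A point of the torus is
recorded by the class `x` of `y / 2π` modulo `ℤ^d`, so that `dy = (2π)^d dx` on the cell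
`Y = [0, 2π)^d`. -/
noncomputable abbrev torusMeasure (d : ℕ) : Measure (UnitAddTorus (Fin d)) :=
  Measure.pi fun _ : Fin d => (AddCircle.haarAddCircle : Measure UnitAddCircle)

/-- The space `L²_♯(Y) = L²(𝕋^d)` of complex-valued `Y`-periodic functions that are square
integrable on `Y`. -/
abbrev L2Per (d : ℕ) : Type := Lp ℂ 2 (torusMeasure d)

/-- The Hilbert basis of `L²_♯(Y)` (for the normalized measure) given by the exponentials
`y ↦ exp (i n · y)`, `n ∈ ℤ^d`. -/
noncomputable def expBasis (d : ℕ) : HilbertBasis (Fin d → ℤ) ℂ (L2Per d) :=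
  UnitAddTorus.mFourierBasis (d := Fin d)

/-- The Fourier coefficient `û(n) = |Y|⁻¹ ∫_Y u(y) exp (-i n · y) dy`. -/
noncomputable def coeff {d : ℕ} (u : L2Per d) (n : Fin d → ℤ) : ℂ :=
  (expBasis d).repr u n

/-- Membership in `H²_♯(Y)`: `∑_n (1 + |n|²)² |û(n)|² < ∞`. -/
def MemH2Per {d : ℕ} (u : L2Per d) : Prop :=
  Summable fun n : Fin d → ℤ => (1 + ∑ j, (n j : ℝ) ^ 2) ^ 2 * ‖coeff u n‖ ^ 2

open Classical in
/-- The distributional derivative `∂u/∂y_j` of a periodic function, i.e. the function with Fourier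
coefficients `i n_j û(n)`, whenever this is an `L²` function. (It is only meant to be used in this
case, which holds for all `u ∈ H¹_♯(Y)`; the value `0` is a convention otherwise.) -/
noncomputable def pderiv {d : ℕ} (j : Fin d) (u : L2Per d) : L2Per d :=
  if h : Memℓp (fun n : Fin d → ℤ => Complex.I * (n j : ℂ) * coeff u n) 2 then
    (expBasis d).repr.symm ⟨_, h⟩
  else 0

/-- The `j`-th component `∂_j u + i η_j u` of the shifted gradient `(∇ + iη) u`. -/
noncomputable def shiftD {d : ℕ} (η : EuclideanSpace ℝ (Fin d)) (j : Fin d) (u : L2Per d) :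
    L2Per d :=
  pderiv j u + (Complex.I * (η j : ℂ)) • u

/-- The shifted Laplacian `(∇ + iη)² u = (∇ + iη) · (∇ + iη) u`. -/
noncomputable def shiftLap {d : ℕ} (η : EuclideanSpace ℝ (Fin d)) (u : L2Per d) : L2Per d :=
  ∑ j, shiftD η j (shiftD η j u)

/-- The representative in the cell `Y = [0, 2π)^d` of a point of the torus. -/
noncomputable def cellPoint {d : ℕ} (x : UnitAddTorus (Fin d)) : Fin d → ℝ :=
  fun j => 2 * Real.pi * (AddCircle.equivIco (1 : ℝ) 0 (x j) : ℝ)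

/-- The integral `∫_Y f(y) dy` over the cell `Y = [0, 2π)^d` of a periodic function, given as a
function on the torus. -/
noncomputable def cellIntegral {d : ℕ} (f : UnitAddTorus (Fin d) → ℂ) : ℂ :=
  ((2 * Real.pi) ^ d : ℝ) * ∫ x, f x ∂torusMeasure d

/-- The inner product `∫_Y u v̄ dy` of `L²_♯(Y)`. -/
noncomputable def innerY {d : ℕ} (u v : L2Per d) : ℂ :=
  cellIntegral fun x => u x * (starRingEnd ℂ) (v x)

/-- The sesquilinear form, on `H²_♯(Y) × H²_♯(Y)`,
`a^ρ[η](u,v) = ∫_Y A (∇+iη)u · conj((∇+iη)v) dy + ρ² ∫_Y (∇+iη)²u conj((∇+iη)²v) dy`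
associated with the shifted operator `ρ² (∇+iη)⁴ - (∇+iη) · A(y) (∇+iη)`. -/
noncomputable def blochForm {d : ℕ} (A : (Fin d → ℝ) → Matrix (Fin d) (Fin d) ℝ) (ρ : ℝ)
    (η : EuclideanSpace ℝ (Fin d)) (u v : L2Per d) : ℂ :=
  cellIntegral (fun x => ∑ j, ∑ k, (A (cellPoint x) j k : ℂ) * shiftD η k u x *
      (starRingEnd ℂ) (shiftD η j v x)) +
    (ρ : ℂ) ^ 2 * cellIntegral (fun x => shiftLap η u x * (starRingEnd ℂ) (shiftLap η v x))

/-- The set of eigenvalues of the Bloch eigenvalue problem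
`ρ² (∇+iη)⁴ φ - (∇+iη) · A(y) (∇+iη) φ = l φ`, `φ` periodic, in its weak form:
there is a nonzero `φ ∈ H²_♯(Y)` with `a^ρ[η](φ,v) = l ∫_Y φ v̄ dy` for all `v ∈ H²_♯(Y)`.
(The form is Hermitian, so that all eigenvalues are real.) -/
def blochEigenvalues {d : ℕ} (A : (Fin d → ℝ) → Matrix (Fin d) (Fin d) ℝ) (ρ : ℝ)
    (η : EuclideanSpace ℝ (Fin d)) : Set ℝ :=
  {l | ∃ φ : L2Per d, MemH2Per φ ∧ φ ≠ 0 ∧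
    ∀ v : L2Per d, MemH2Per v → blochForm A ρ η φ v = (l : ℂ) * innerY φ v}

/-- The first Bloch eigenvalue `λ₁^ρ(η)`, the smallest eigenvalue. -/
noncomputable def firstBlochEigenvalue {d : ℕ} (A : (Fin d → ℝ) → Matrix (Fin d) (Fin d) ℝ)
    (ρ : ℝ) (η : EuclideanSpace ℝ (Fin d)) : ℝ :=
  sInf (blochEigenvalues A ρ η)

end BlochWave

/-!
Conjugation with `(1 - Δ)⁻¹`, which maps `L²_♯` isomorphically onto `H²_♯`, turns the weak problem
into `T(η) f = l B f` for bounded self-adjoint operators on `L²_♯`, with `B = (1 - Δ)⁻²` and with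
`T(η)` a polynomial in `η`.

By ellipticity the form of `T(η)` dominates the Fourier multiplier with symbol
`(α |n + η|² + ρ² |n + η|⁴) (1 + |n|²)⁻²`, and for `|η| ≤ 1/2` and `n ≠ 0` the first factor is at
least `μ = α/4 + ρ²/16`. Hence `T(η) - l B + μ ⟨1, ·⟩ 1` is coercive for all `l < μ`, and
`l < μ` is an eigenvalue if and only if a scalar secular equation holds. Its left-hand side is
analytic in `(η, l)` and strictly increasing in `l`, so there is at most one eigenvalue below `μ`
and the implicit function theorem makes it analytic in `η`.

There is such an eigenvalue as soon as the Rayleigh quotient of the constant function lies below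
`μ`. This quotient is `O(|η|²) + ρ² |η|⁴`, with the first term independent of `ρ`; comparing it
with `α/4`, and `|η|⁴` with `1/16`, gives a radius independent of `ρ`.
-/

namespace BlochWave

open scoped InnerProductSpace Topology ContDiff ENNReal

section RankOneGap

variable {E : Type*} [NormedAddCommGroup E] [InnerProductSpace ℂ E]

/-- The real eigenvalues of the generalized eigenvalue problem `T f = l B f`. -/
def pencilEigenvalues (T B : E →L[ℂ] E) : Set ℝ :=
  {l | ∃ f : E, f ≠ 0 ∧ T f = (l : ℂ) • B f}

/-- The operator pencil `T - l B`. -/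
noncomputable def pencil (T B : E →L[ℂ] E) (l : ℝ) : E →L[ℂ] E :=
  T - (l : ℂ) • B

/-- The rank-one perturbation `T - l B + ⟨w, ·⟩ w` of the pencil `T - l B`. -/
noncomputable def perturbedPencil (T B : E →L[ℂ] E) (w : E) (l : ℝ) : E →L[ℂ] E :=
  pencil T B l + InnerProductSpace.rankOne ℂ w w

/-- The solution `f` of `(T - l B + ⟨w, ·⟩ w) f = w`; a junk value where the perturbed pencil is not
invertible. -/
noncomputable def response (T B : E →L[ℂ] E) (w : E) (l : ℝ) : E :=
  Ring.inverse (perturbedPencil T B w l) w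

/-- The secular function `⟨w, (T - l B + ⟨w, ·⟩ w)⁻¹ w⟩` of the rank-one perturbation: where the
perturbed pencil is invertible, `l` is an eigenvalue of the pencil iff the value at `l` is `1`. -/
noncomputable def secularFun (T B : E →L[ℂ] E) (w : E) (l : ℝ) : ℝ :=
  (⟪w, response T B w l⟫_ℂ).re

/-- The spectrum of the symmetric problem `T f = l B f` below `μ` is a single simple eigenvalue:
there are trial vectors on both sides of it, and a perturbation in the single direction `w` removes
it. -/
structure RankOneGap (T B : E →L[ℂ] E) (w : E) (μ : ℝ) : Prop where
  left_symm : ∀ x y, ⟪T x, y⟫_ℂ = ⟪x, T y⟫_ℂ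
  right_symm : ∀ x y, ⟪B x, y⟫_ℂ = ⟪x, B y⟫_ℂ
  right_pos : ∀ f ≠ 0, 0 < (⟪B f, f⟫_ℂ).re
  coercive : ∀ l < μ, ∃ c > 0, ∀ f,
    c * ‖f‖ ^ 2 ≤ (⟪pencil T B l f, f⟫_ℂ).re + ‖⟪w, f⟫_ℂ‖ ^ 2
  exists_nonneg : ∃ l < μ, ∀ f, 0 ≤ (⟪pencil T B l f, f⟫_ℂ).re
  exists_nonpos : ∃ l < μ, ∃ f ≠ 0, (⟪pencil T B l f, f⟫_ℂ).re ≤ 0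

variable {T B : E →L[ℂ] E} {w : E} {μ l : ℝ}

lemma pencil_apply (f : E) : pencil T B l f = T f - (l : ℂ) • B f := rfl

lemma perturbedPencil_apply (f : E) :
    perturbedPencil T B w l f = pencil T B l f + ⟪w, f⟫_ℂ • w := rfl

lemma re_inner_perturbedPencil (f : E) :
    (⟪perturbedPencil T B w l f, f⟫_ℂ).re = (⟪pencil T B l f, f⟫_ℂ).re + ‖⟪w, f⟫_ℂ‖ ^ 2 := by
  rw [perturbedPencil_apply, inner_add_left, inner_smul_left, Complex.add_re,
    ← Complex.normSq_eq_conj_mul_self, Complex.ofReal_re, Complex.normSq_eq_norm_sq]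

lemma perturbedPencil_response (hl : IsUnit (perturbedPencil T B w l)) :
    perturbedPencil T B w l (response T B w l) = w :=
  DFunLike.congr_fun (Ring.mul_inverse_cancel _ hl) w

section Analytic

variable [CompleteSpace E]

lemma analyticAt_secularFun {X : Type*} [NormedAddCommGroup X] [NormedSpace ℝ X]
    {T : X → E →L[ℂ] E} {x : X} (hT : AnalyticAt ℝ T x)
    (hl : IsUnit (perturbedPencil (T x) B w l)) :
    AnalyticAt ℝ (fun p : X × ℝ => secularFun (T p.1) B w p.2) (x, l) := by
  obtain ⟨u, hu⟩ := hl
  have hpencil : AnalyticAt ℝ (fun p : X × ℝ => perturbedPencil (T p.1) B w p.2) (x, l) :=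
    ((hT.comp_of_eq analyticAt_fst rfl).sub
      (((Complex.ofRealCLM.analyticAt _).comp analyticAt_snd).smul analyticAt_const)).add
      analyticAt_const
  have hinv : AnalyticAt ℝ (fun p : X × ℝ => Ring.inverse (perturbedPencil (T p.1) B w p.2))
      (x, l) := (analyticAt_inverse u).comp_of_eq hpencil hu.symm
  let matrixElement : (E →L[ℂ] E) →L[ℝ] ℝ :=
    Complex.reCLM ∘L (innerSL ℂ w ∘L ContinuousLinearMap.apply ℂ E w).restrictScalars ℝ
  exact (matrixElement.analyticAt _).comp hinv

end Analytic

namespace RankOneGap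

lemma perturbedPencil_symm (h : RankOneGap T B w μ) (x y : E) :
    ⟪perturbedPencil T B w l x, y⟫_ℂ = ⟪x, perturbedPencil T B w l y⟫_ℂ := by
  simp only [perturbedPencil_apply, pencil_apply, inner_add_left, inner_sub_left, inner_smul_left,
    inner_add_right, inner_sub_right, inner_smul_right, Complex.conj_ofReal, h.left_symm,
    h.right_symm, inner_conj_symm]
  ring

variable [CompleteSpace E]

lemma isUnit_perturbedPencil (h : RankOneGap T B w μ) (hl : l < μ) :
    IsUnit (perturbedPencil T B w l) := by
  obtain ⟨c, hc, hcoercive⟩ := h.coercive l hl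
  refine ContinuousLinearMap.isUnit_of_forall_le_norm_inner_map _ (c := ⟨c, hc.le⟩) hc fun f => ?_
  calc ‖f‖ ^ 2 * c ≤ (⟪perturbedPencil T B w l f, f⟫_ℂ).re := by
        rw [re_inner_perturbedPencil, mul_comm]
        exact hcoercive f
    _ ≤ ‖⟪perturbedPencil T B w l f, f⟫_ℂ‖ := Complex.re_le_norm _

lemma inverse_symm (h : RankOneGap T B w μ) (hl : l < μ) (x y : E) :
    ⟪Ring.inverse (perturbedPencil T B w l) x, y⟫_ℂ
      = ⟪x, Ring.inverse (perturbedPencil T B w l) y⟫_ℂ := by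
  have hcancel (z : E) : perturbedPencil T B w l (Ring.inverse (perturbedPencil T B w l) z) = z :=
    DFunLike.congr_fun (Ring.mul_inverse_cancel _ (h.isUnit_perturbedPencil hl)) z
  conv_lhs => rw [← hcancel y]
  rw [← h.perturbedPencil_symm, hcancel]

lemma inner_response (h : RankOneGap T B w μ) (hl : l < μ) :
    ⟪w, response T B w l⟫_ℂ = secularFun T B w l := by
  refine (Complex.conj_eq_iff_re.mp ?_).symm
  rw [inner_conj_symm, response, h.inverse_symm hl]

lemma mem_pencilEigenvalues_iff (h : RankOneGap T B w μ) (hl : l < μ) :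
    l ∈ pencilEigenvalues T B ↔ secularFun T B w l = 1 := by
  constructor
  · rintro ⟨f, hf, heq⟩
    have hmap : perturbedPencil T B w l f = ⟪w, f⟫_ℂ • w := by
      rw [perturbedPencil_apply, pencil_apply, heq, sub_self, zero_add]
    have hsolve : f = ⟪w, f⟫_ℂ • response T B w l := by
      rw [response, ← map_smul, ← hmap]
      exact (DFunLike.congr_fun
        (Ring.inverse_mul_cancel _ (h.isUnit_perturbedPencil hl)) f).symm
    have hne : ⟪w, f⟫_ℂ ≠ 0 := fun h0 => hf (by rwa [h0, zero_smul] at hsolve)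
    have hinner : ⟪w, f⟫_ℂ * secularFun T B w l = ⟪w, f⟫_ℂ * 1 := by
      rw [← h.inner_response hl, ← inner_smul_right, ← hsolve, mul_one]
    exact_mod_cast mul_left_cancel₀ hne hinner
  · intro hone
    refine ⟨response T B w l, fun h0 => ?_, ?_⟩
    · simp [secularFun, h0] at hone
    · have hresponse := perturbedPencil_response (h.isUnit_perturbedPencil hl)
      rw [perturbedPencil_apply, h.inner_response hl, hone, Complex.ofReal_one, one_smul,
        add_eq_right, pencil_apply] at hresponse
      exact sub_eq_zero.mp hresponse

lemma secularFun_le_one (h : RankOneGap T B w μ) (hl : l < μ)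
    (hnonneg : ∀ f, 0 ≤ (⟪pencil T B l f, f⟫_ℂ).re) : secularFun T B w l ≤ 1 := by
  have hre := re_inner_perturbedPencil (T := T) (B := B) (w := w) (l := l) (response T B w l)
  rw [perturbedPencil_response (h.isUnit_perturbedPencil hl), h.inner_response hl,
    Complex.ofReal_re, Complex.norm_real, Real.norm_eq_abs, sq_abs] at hre
  nlinarith [hnonneg (response T B w l)]

lemma one_le_secularFun (h : RankOneGap T B w μ) (hl : l < μ) {e : E} (he : e ≠ 0)
    (hnonpos : (⟪pencil T B l e, e⟫_ℂ).re ≤ 0) : 1 ≤ secularFun T B w l := by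
  obtain ⟨c, hc, hcoercive⟩ := h.coercive l hl
  set f := response T B w l
  have hPf : perturbedPencil T B w l f = w := perturbedPencil_response (h.isUnit_perturbedPencil hl)
  have hwe : 0 < ‖⟪w, e⟫_ℂ‖ ^ 2 := by
    have := hcoercive e
    have : 0 < c * ‖e‖ ^ 2 := by positivity
    linarith
  -- The perturbed pencil is positive at the defect `⟨w, e⟩ f - e`, where it equals `-(T - l B) e`.
  have hpos : 0 ≤ (⟪perturbedPencil T B w l (⟪w, e⟫_ℂ • f - e), ⟪w, e⟫_ℂ • f - e⟫_ℂ).re := by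
    rw [re_inner_perturbedPencil]
    exact le_trans (by positivity) (hcoercive _)
  have hexpand : ⟪perturbedPencil T B w l (⟪w, e⟫_ℂ • f - e), ⟪w, e⟫_ℂ • f - e⟫_ℂ
      = ((‖⟪w, e⟫_ℂ‖ ^ 2 * (secularFun T B w l - 1) : ℝ) : ℂ) + ⟪pencil T B l e, e⟫_ℂ := by
    have hPe : ⟪pencil T B l e, f⟫_ℂ = ⟪e, w⟫_ℂ * (1 - secularFun T B w l) := by
      have := h.perturbedPencil_symm (l := l) e f
      rw [hPf, perturbedPencil_apply, inner_add_left, inner_smul_left, inner_conj_symm,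
        h.inner_response hl] at this
      linear_combination this
    have hnorm : ((‖⟪w, e⟫_ℂ‖ ^ 2 : ℝ) : ℂ) = ⟪w, e⟫_ℂ * ⟪e, w⟫_ℂ := by
      rw [← inner_conj_symm e w, Complex.mul_conj, Complex.normSq_eq_norm_sq]
    rw [map_sub, map_smul, hPf, perturbedPencil_apply, sub_add_cancel_right, inner_neg_left,
      inner_sub_right, inner_smul_right, hPe, Complex.ofReal_mul, hnorm]
    push_cast
    ring
  rw [hexpand, Complex.add_re, Complex.ofReal_re] at hpos
  have : 0 ≤ ‖⟪w, e⟫_ℂ‖ ^ 2 * (secularFun T B w l - 1) := by linarith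
  linarith [nonneg_of_mul_nonneg_right this hwe]

lemma hasDerivAt_secularFun (h : RankOneGap T B w μ) (hl : l < μ) :
    HasDerivAt (secularFun T B w) (⟪B (response T B w l), response T B w l⟫_ℂ).re l := by
  obtain ⟨u, hu⟩ := h.isUnit_perturbedPencil hl
  have hpencil : HasDerivAt (perturbedPencil T B w) (-B) l := by
    have hsmul : HasDerivAt (fun l : ℝ => (l : ℂ) • B) B l := by
      simpa using (Complex.ofRealCLM.hasDerivAt (x := l)).smul_const B
    exact (hsmul.const_sub T).add_const (InnerProductSpace.rankOne ℂ w w)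
  have hinverse := hasFDerivAt_ringInverse (𝕜 := ℝ) u
  have hcoe : (↑u⁻¹ : E →L[ℂ] E) = Ring.inverse (perturbedPencil T B w l) := by
    rw [← hu, Ring.inverse_unit]
  rw [hcoe, hu] at hinverse
  let matrixElement : (E →L[ℂ] E) →L[ℝ] ℝ :=
    Complex.reCLM ∘L (innerSL ℂ w ∘L ContinuousLinearMap.apply ℂ E w).restrictScalars ℝ
  convert! matrixElement.hasFDerivAt.comp_hasDerivAt l (hinverse.comp_hasDerivAt l hpencil) using 1
  change _ = (⟪w, (-(Ring.inverse (perturbedPencil T B w l) * -B *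
    Ring.inverse (perturbedPencil T B w l))) w⟫_ℂ).re
  rw [mul_neg, neg_mul, neg_neg, h.right_symm, response, mul_apply_eq_comp,
    mul_apply_eq_comp, ← h.inverse_symm hl w]

lemma response_ne_zero (h : RankOneGap T B w μ) (hl : l < μ) : response T B w l ≠ 0 := by
  intro hzero
  have hw : w = 0 := by
    rw [← perturbedPencil_response (h.isUnit_perturbedPencil hl), hzero, map_zero]
  obtain ⟨l', hl', e, he, hnonpos⟩ := h.exists_nonpos
  have hone := h.one_le_secularFun hl' he hnonpos
  rw [secularFun, hw, inner_zero_left, Complex.zero_re] at hone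
  exact absurd hone (by norm_num)

lemma secularFun_deriv_pos (h : RankOneGap T B w μ) (hl : l < μ) :
    0 < (⟪B (response T B w l), response T B w l⟫_ℂ).re :=
  h.right_pos _ (h.response_ne_zero hl)

lemma continuousOn_secularFun (h : RankOneGap T B w μ) :
    ContinuousOn (secularFun T B w) (Set.Iio μ) :=
  fun _ hl => (h.hasDerivAt_secularFun hl).continuousAt.continuousWithinAt

lemma strictMonoOn_secularFun (h : RankOneGap T B w μ) :
    StrictMonoOn (secularFun T B w) (Set.Iio μ) := by
  refine strictMonoOn_of_deriv_pos (convex_Iio μ) h.continuousOn_secularFun fun l hl => ?_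
  rw [interior_Iio] at hl
  rw [(h.hasDerivAt_secularFun hl).deriv]
  exact h.secularFun_deriv_pos hl

lemma exists_eigenvalue (h : RankOneGap T B w μ) : ∃ l < μ, l ∈ pencilEigenvalues T B := by
  obtain ⟨l₀, hl₀, hnonneg⟩ := h.exists_nonneg
  obtain ⟨l₁, hl₁, e, he, hnonpos⟩ := h.exists_nonpos
  have hsub : Set.uIcc l₀ l₁ ⊆ Set.Iio μ := Set.ordConnected_Iio.uIcc_subset hl₀ hl₁
  obtain ⟨l, hl, hone⟩ := intermediate_value_uIcc (h.continuousOn_secularFun.mono hsub)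
    (Set.Icc_subset_uIcc ⟨h.secularFun_le_one hl₀ hnonneg, h.one_le_secularFun hl₁ he hnonpos⟩)
  exact ⟨l, hsub hl, (h.mem_pencilEigenvalues_iff (hsub hl)).2 hone⟩

lemma isLeast_of_mem (h : RankOneGap T B w μ) (hl : l < μ) (hmem : l ∈ pencilEigenvalues T B) :
    IsLeast (pencilEigenvalues T B) l := by
  refine ⟨hmem, fun l' hmem' => ?_⟩
  rcases le_or_gt μ l' with hl' | hl'
  · exact hl.le.trans hl'
  · rw [h.mem_pencilEigenvalues_iff hl] at hmem
    rw [h.mem_pencilEigenvalues_iff hl'] at hmem'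
    exact (h.strictMonoOn_secularFun.injOn hl hl' (hmem.trans hmem'.symm)).le

lemma isLeast_sInf (h : RankOneGap T B w μ) :
    IsLeast (pencilEigenvalues T B) (sInf (pencilEigenvalues T B)) := by
  obtain ⟨l, hl, hmem⟩ := h.exists_eigenvalue
  have hleast := h.isLeast_of_mem hl hmem
  rwa [hleast.csInf_eq]

theorem analyticOnNhd_sInf {X : Type*} [NormedAddCommGroup X] [NormedSpace ℝ X] [CompleteSpace X]
    {T : X → E →L[ℂ] E} {U : Set X} (hT : AnalyticOnNhd ℝ T U) (hU : IsOpen U)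
    (h : ∀ x ∈ U, RankOneGap (T x) B w μ) :
    AnalyticOnNhd ℝ (fun x => sInf (pencilEigenvalues (T x) B)) U := by
  intro x hx
  obtain ⟨l, hl, hmem⟩ := (h x hx).exists_eigenvalue
  let F : X × ℝ → ℝ := fun p => secularFun (T p.1) B w p.2
  have hF : ContDiffAt ℝ ω F (x, l) :=
    (analyticAt_secularFun (hT x hx) ((h x hx).isUnit_perturbedPencil hl)).contDiffAt
  have hpartial : fderiv ℝ F (x, l) (0, 1)
      = (⟪B (response (T x) B w l), response (T x) B w l⟫_ℂ).re := by
    have hline : HasDerivAt (fun s : ℝ => (x, s)) ((0 : X), (1 : ℝ)) l :=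
      (hasDerivAt_const l x).prodMk (hasDerivAt_id l)
    exact ((hF.differentiableAt (by simp)).hasFDerivAt.comp_hasDerivAt l hline).unique
      ((h x hx).hasDerivAt_secularFun hl)
  have hinv : (fderiv ℝ F (x, l) ∘L .inr ℝ X ℝ).IsInvertible := by
    refine ⟨ContinuousLinearEquiv.unitsEquivAut ℝ
      (Units.mk0 _ ((h x hx).secularFun_deriv_pos hl).ne'), ?_⟩
    ext
    simp [← hpartial]
  have hcont := hF.contDiffAt_implicitFunction (by simp) hinv
  have hself := hF.implicitFunction_apply_self (by simp) hinv
  have hsolves := hF.eventually_apply_implicitFunction (by simp) hinv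
  set ψ := hF.implicitFunction (by simp) hinv
  have hlt : ∀ᶠ y in 𝓝 x, ψ y < μ :=
    hcont.continuousAt.eventually_lt continuousAt_const (by simpa only [hself] using hl)
  refine hcont.analyticAt.congr ?_
  filter_upwards [hsolves, hlt, hU.mem_nhds hx] with y hy hyμ hyU
  refine (((h y hyU).isLeast_of_mem hyμ ?_).csInf_eq).symm
  rw [(h y hyU).mem_pencilEigenvalues_iff hyμ]
  exact Eq.trans hy (((h x hx).mem_pencilEigenvalues_iff hl).1 hmem)

end RankOneGap
end RankOneGap

section Diagonal

variable {ι 𝕜 E : Type*} [RCLike 𝕜] [NormedAddCommGroup E] [InnerProductSpace 𝕜 E]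
  (b : HilbertBasis ι 𝕜 E)

lemma hasSum_sq_repr (x : E) : HasSum (fun i => ‖b.repr x i‖ ^ 2) (‖x‖ ^ 2) := by
  simpa using lp.hasSum_norm (p := 2) (by norm_num) (b.repr x)

/-- The operator that is diagonal in the Hilbert basis `b`, with the bounded symbol `m`. -/
noncomputable def diagonal (m : ι → 𝕜) {C : ℝ} (hC : 0 ≤ C) (hm : ∀ i, ‖m i‖ ≤ C) : E →L[𝕜] E :=
  b.repr.symm.toContinuousLinearEquiv ∘L
    lp.mapCLM 2 (fun i => m i • ContinuousLinearMap.id 𝕜 𝕜) hC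
      (fun i => by simpa [norm_smul] using hm i) ∘L b.repr.toContinuousLinearEquiv

lemma repr_diagonal (m : ι → 𝕜) {C : ℝ} (hC : 0 ≤ C) (hm : ∀ i, ‖m i‖ ≤ C) (x : E) (i : ι) :
    b.repr (diagonal b m hC hm x) i = m i * b.repr x i := by
  simp [diagonal]

end Diagonal

section Fourier

variable {d : ℕ}

lemma ext_coeff {u v : L2Per d} (h : ∀ n, coeff u n = coeff v n) : u = v :=
  (expBasis d).repr.injective (lp.ext (funext h))

lemma coeff_zero (n : Fin d → ℤ) : coeff (0 : L2Per d) n = 0 := by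
  simp [coeff]

lemma coeff_add (u v : L2Per d) (n : Fin d → ℤ) : coeff (u + v) n = coeff u n + coeff v n := by
  simp [coeff]

lemma coeff_sub (u v : L2Per d) (n : Fin d → ℤ) : coeff (u - v) n = coeff u n - coeff v n := by
  simp [coeff]

lemma coeff_smul (c : ℂ) (u : L2Per d) (n : Fin d → ℤ) : coeff (c • u) n = c * coeff u n := by
  simp [coeff]

lemma coeff_sum {ι : Type*} (s : Finset ι) (u : ι → L2Per d) (n : Fin d → ℤ) :
    coeff (∑ i ∈ s, u i) n = ∑ i ∈ s, coeff (u i) n := by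
  simp only [coeff, HilbertBasis.repr_apply_apply, inner_sum]

lemma hasSum_inner_coeff (u v : L2Per d) :
    HasSum (fun n => ⟪coeff u n, coeff v n⟫_ℂ) ⟪u, v⟫_ℂ := by
  rw [← (expBasis d).repr.inner_map_map]
  exact lp.hasSum_inner _ _

lemma hasSum_sq_coeff (u : L2Per d) : HasSum (fun n => ‖coeff u n‖ ^ 2) (‖u‖ ^ 2) :=
  hasSum_sq_repr (expBasis d) u

lemma pderiv_eq {j : Fin d} {u v : L2Per d}
    (h : ∀ n, coeff v n = Complex.I * (n j : ℂ) * coeff u n) : pderiv j u = v := by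
  have hv : (fun n : Fin d → ℤ => Complex.I * (n j : ℂ) * coeff u n) = (expBasis d).repr v :=
    funext fun n => (h n).symm
  have hmem : Memℓp (fun n : Fin d → ℤ => Complex.I * (n j : ℂ) * coeff u n) 2 :=
    hv ▸ lp.memℓp _
  rw [pderiv, dif_pos hmem, LinearIsometryEquiv.symm_apply_eq]
  exact lp.ext hv

lemma shiftD_eq {η : EuclideanSpace ℝ (Fin d)} {j : Fin d} {u v : L2Per d}
    (h : ∀ n, coeff v n = Complex.I * (n j + η j) * coeff u n) : shiftD η j u = v := by
  rw [shiftD, pderiv_eq (v := v - (Complex.I * (η j : ℂ)) • u), sub_add_cancel]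
  intro n
  rw [coeff_sub, coeff_smul, h]
  ring

/-- The squared length `|n|²` of a frequency. -/
def freqSq (n : Fin d → ℤ) : ℝ := ∑ j, (n j : ℝ) ^ 2

lemma freqSq_nonneg (n : Fin d → ℤ) : 0 ≤ freqSq n := Finset.sum_nonneg fun _ _ => sq_nonneg _

lemma sq_le_freqSq (n : Fin d → ℤ) (j : Fin d) : (n j : ℝ) ^ 2 ≤ freqSq n :=
  Finset.single_le_sum (f := fun j => (n j : ℝ) ^ 2) (fun _ _ => sq_nonneg _) (Finset.mem_univ j)

lemma one_le_freqSq {n : Fin d → ℤ} (hn : n ≠ 0) : 1 ≤ freqSq n := by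
  obtain ⟨j, hj⟩ := Function.ne_iff.mp hn
  have hsq : (1 : ℤ) ≤ n j ^ 2 := Int.add_one_le_of_lt (sq_pos_of_ne_zero hj)
  exact le_trans (mod_cast hsq) (sq_le_freqSq n j)

/-- The squared length `|n + η|²` of a shifted frequency. -/
noncomputable def shiftSq (η : EuclideanSpace ℝ (Fin d)) (n : Fin d → ℤ) : ℝ :=
  ∑ j, ((n j : ℝ) + η j) ^ 2

lemma shiftSq_nonneg (η : EuclideanSpace ℝ (Fin d)) (n : Fin d → ℤ) : 0 ≤ shiftSq η n :=
  Finset.sum_nonneg fun _ _ => sq_nonneg _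

lemma shiftSq_zero (η : EuclideanSpace ℝ (Fin d)) : shiftSq η 0 = ‖η‖ ^ 2 := by
  simp [shiftSq, EuclideanSpace.real_norm_sq_eq]

lemma freqSq_div_four_le_shiftSq {η : EuclideanSpace ℝ (Fin d)} (hη : ‖η‖ ≤ 1 / 2)
    {n : Fin d → ℤ} (hn : n ≠ 0) : freqSq n / 4 ≤ shiftSq η n := by
  have hshift : freqSq n / 2 - ‖η‖ ^ 2 ≤ shiftSq η n := by
    rw [freqSq, shiftSq, EuclideanSpace.real_norm_sq_eq, Finset.sum_div, ← Finset.sum_sub_distrib]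
    refine Finset.sum_le_sum fun j _ => ?_
    nlinarith [sq_nonneg ((n j : ℝ) + 2 * η j)]
  nlinarith [one_le_freqSq hn, norm_nonneg η]

/-- The symbol `(1 + |n|²)⁻¹` of `(1 - Δ)⁻¹`. -/
noncomputable def weight (n : Fin d → ℤ) : ℝ := (1 + freqSq n)⁻¹

lemma weight_pos (n : Fin d → ℤ) : 0 < weight n :=
  inv_pos.2 (by linarith [freqSq_nonneg n])

lemma weight_mul (n : Fin d → ℤ) : weight n * (1 + freqSq n) = 1 :=
  inv_mul_cancel₀ (by linarith [freqSq_nonneg n])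

lemma weight_zero : weight (0 : Fin d → ℤ) = 1 := by simp [weight, freqSq]

lemma norm_mul_weight_le {z : ℂ} {n : Fin d → ℤ} (hz : ‖z‖ ≤ 1 + freqSq n) :
    ‖z * weight n‖ ≤ 1 := by
  rw [norm_mul, Complex.norm_real, Real.norm_of_nonneg (weight_pos n).le, ← weight_mul n, mul_comm]
  exact mul_le_mul_of_nonneg_left hz (weight_pos n).le

/-- The Fourier multiplier `p(D) (1 - Δ)⁻¹`, for a symbol `p` of order at most two. -/
noncomputable def orderTwoOp (p : (Fin d → ℤ) → ℂ) (hp : ∀ n, ‖p n‖ ≤ 1 + freqSq n) :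
    L2Per d →L[ℂ] L2Per d :=
  diagonal (expBasis d) (fun n => p n * weight n) zero_le_one fun n => norm_mul_weight_le (hp n)

lemma coeff_orderTwoOp (p : (Fin d → ℤ) → ℂ) (hp : ∀ n, ‖p n‖ ≤ 1 + freqSq n) (f : L2Per d)
    (n : Fin d → ℤ) : coeff (orderTwoOp p hp f) n = p n * weight n * coeff f n :=
  repr_diagonal (expBasis d) _ _ _ f n

/-- The operator `(1 - Δ)⁻¹`, an isomorphism from `L²_♯` onto `H²_♯`. -/
noncomputable def smoothing (d : ℕ) : L2Per d →L[ℂ] L2Per d :=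
  orderTwoOp 1 fun n => by simpa using freqSq_nonneg n

/-- The operator `∂_j (1 - Δ)⁻¹`. -/
noncomputable def gradOp (j : Fin d) : L2Per d →L[ℂ] L2Per d :=
  orderTwoOp (fun n => Complex.I * n j) fun n => by
    have hsq := sq_le_freqSq n j
    rw [← sq_abs] at hsq
    rw [norm_mul, Complex.norm_I, one_mul, Complex.norm_intCast]
    nlinarith [sq_nonneg (|(n j : ℝ)| - 1)]

/-- The operator `∂_j² (1 - Δ)⁻¹`. -/
noncomputable def hessOp (j : Fin d) : L2Per d →L[ℂ] L2Per d :=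
  orderTwoOp (fun n => -(n j : ℂ) ^ 2) fun n => by
    rw [norm_neg, norm_pow, Complex.norm_intCast, sq_abs]
    linarith [sq_le_freqSq n j]

/-- The operator `(∂_j + i η_j) (1 - Δ)⁻¹`. -/
noncomputable def shiftGradOp (η : EuclideanSpace ℝ (Fin d)) (j : Fin d) :
    L2Per d →L[ℂ] L2Per d :=
  gradOp j + (Complex.I * (η j : ℂ)) • smoothing d

/-- The operator `(∂_j + i η_j)² (1 - Δ)⁻¹`. -/
noncomputable def shiftHessOp (η : EuclideanSpace ℝ (Fin d)) (j : Fin d) :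
    L2Per d →L[ℂ] L2Per d :=
  hessOp j + (2 * Complex.I * (η j : ℂ)) • gradOp j - ((η j : ℂ) ^ 2) • smoothing d

/-- The operator `(∇ + i η)² (1 - Δ)⁻¹`. -/
noncomputable def shiftLapOp (η : EuclideanSpace ℝ (Fin d)) : L2Per d →L[ℂ] L2Per d :=
  ∑ j, shiftHessOp η j

lemma coeff_smoothing (f : L2Per d) (n : Fin d → ℤ) :
    coeff (smoothing d f) n = weight n * coeff f n := by
  rw [smoothing, coeff_orderTwoOp, Pi.one_apply, one_mul]

lemma coeff_shiftGradOp (η : EuclideanSpace ℝ (Fin d)) (j : Fin d) (f : L2Per d)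
    (n : Fin d → ℤ) :
    coeff (shiftGradOp η j f) n = Complex.I * (n j + η j) * weight n * coeff f n := by
  rw [shiftGradOp, add_apply, smul_apply, coeff_add, coeff_smul, coeff_smoothing, gradOp,
    coeff_orderTwoOp]
  ring

lemma coeff_shiftHessOp (η : EuclideanSpace ℝ (Fin d)) (j : Fin d) (f : L2Per d)
    (n : Fin d → ℤ) :
    coeff (shiftHessOp η j f) n = -(n j + η j) ^ 2 * weight n * coeff f n := by
  rw [shiftHessOp, sub_apply, add_apply, smul_apply, smul_apply, coeff_sub, coeff_add, coeff_smul,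
    coeff_smul, coeff_smoothing, gradOp, hessOp, coeff_orderTwoOp, coeff_orderTwoOp]
  linear_combination 2 * η j * n j * weight n * coeff f n * Complex.I_sq

lemma coeff_shiftLapOp (η : EuclideanSpace ℝ (Fin d)) (f : L2Per d) (n : Fin d → ℤ) :
    coeff (shiftLapOp η f) n = -(shiftSq η n : ℂ) * weight n * coeff f n := by
  rw [shiftLapOp, sum_apply, coeff_sum]
  simp only [coeff_shiftHessOp, ← Finset.sum_mul, Finset.sum_neg_distrib, shiftSq]
  push_cast
  rfl

lemma sum_sq_coeff_shiftGradOp (η : EuclideanSpace ℝ (Fin d)) (f : L2Per d) (n : Fin d → ℤ) :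
    ∑ j, ‖coeff (shiftGradOp η j f) n‖ ^ 2 = shiftSq η n * ‖coeff (smoothing d f) n‖ ^ 2 := by
  rw [shiftSq, Finset.sum_mul]
  refine Finset.sum_congr rfl fun j _ => ?_
  rw [coeff_shiftGradOp, mul_assoc, ← coeff_smoothing, norm_mul, norm_mul, Complex.norm_I, one_mul,
    mul_pow, ← sq_abs (_ + _), ← Real.norm_eq_abs, ← Complex.norm_real]
  push_cast
  rfl

lemma sq_coeff_shiftLapOp (η : EuclideanSpace ℝ (Fin d)) (f : L2Per d) (n : Fin d → ℤ) :
    ‖coeff (shiftLapOp η f) n‖ ^ 2 = shiftSq η n ^ 2 * ‖coeff (smoothing d f) n‖ ^ 2 := by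
  rw [coeff_shiftLapOp, mul_assoc, ← coeff_smoothing, norm_mul, norm_neg, Complex.norm_real,
    mul_pow, Real.norm_eq_abs, sq_abs]

lemma shiftD_smoothing (η : EuclideanSpace ℝ (Fin d)) (j : Fin d) (f : L2Per d) :
    shiftD η j (smoothing d f) = shiftGradOp η j f :=
  shiftD_eq fun n => by rw [coeff_shiftGradOp, coeff_smoothing, mul_assoc]

lemma shiftD_shiftGradOp (η : EuclideanSpace ℝ (Fin d)) (j : Fin d) (f : L2Per d) :
    shiftD η j (shiftGradOp η j f) = shiftHessOp η j f :=
  shiftD_eq fun n => by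
    rw [coeff_shiftHessOp, coeff_shiftGradOp]
    linear_combination -((n j + η j) ^ 2 * weight n * coeff f n) * Complex.I_sq

lemma shiftLap_smoothing (η : EuclideanSpace ℝ (Fin d)) (f : L2Per d) :
    shiftLap η (smoothing d f) = shiftLapOp η f := by
  simp only [shiftLap, shiftD_smoothing, shiftD_shiftGradOp, shiftLapOp, sum_apply]

lemma memH2Per_iff {u : L2Per d} : MemH2Per u ↔ ∃ f, smoothing d f = u := by
  constructor
  · intro hu
    have hmem : Memℓp (fun n : Fin d → ℤ => ((1 + freqSq n : ℝ) : ℂ) * coeff u n) 2 := by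
      refine memℓp_gen (hu.congr fun n => ?_)
      rw [ENNReal.toReal_ofNat, Real.rpow_two, norm_mul, mul_pow, Complex.norm_real,
        Real.norm_eq_abs, sq_abs, freqSq]
    refine ⟨(expBasis d).repr.symm ⟨_, hmem⟩, ext_coeff fun n => ?_⟩
    rw [coeff_smoothing, coeff, LinearIsometryEquiv.apply_symm_apply]
    rw [← mul_assoc, ← Complex.ofReal_mul, weight_mul, Complex.ofReal_one, one_mul]
  · rintro ⟨f, rfl⟩
    refine (hasSum_sq_coeff f).summable.congr fun n => ?_
    rw [← freqSq, coeff_smoothing, norm_mul, mul_pow, Complex.norm_real, Real.norm_eq_abs, sq_abs,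
      ← mul_assoc, ← mul_pow, mul_comm _ (weight n), weight_mul, one_pow, one_mul]

lemma smoothing_symm (u v : L2Per d) : ⟪smoothing d u, v⟫_ℂ = ⟪u, smoothing d v⟫_ℂ := by
  refine (hasSum_inner_coeff _ _).unique ?_
  convert hasSum_inner_coeff u (smoothing d v) using 2 with n
  simp only [coeff_smoothing, RCLike.inner_apply, map_mul, Complex.conj_ofReal]
  ring

lemma smoothing_injective : Function.Injective (smoothing d) := by
  refine (injective_iff_map_eq_zero _).2 fun u hu => ext_coeff fun n => ?_
  have hcoeff := coeff_smoothing u n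
  rw [hu, coeff_zero, zero_eq_mul, Complex.ofReal_eq_zero] at hcoeff
  rw [coeff_zero, hcoeff.resolve_left (weight_pos n).ne']

/-- The constant function `1` as an element of `L²_♯`. -/
noncomputable def constOne (d : ℕ) : L2Per d := expBasis d 0

lemma inner_constOne (f : L2Per d) : ⟪constOne d, f⟫_ℂ = coeff f 0 :=
  ((expBasis d).repr_apply_apply f 0).symm

lemma norm_constOne : ‖constOne d‖ = 1 := (expBasis d).orthonormal.1 0

lemma coeff_constOne_of_ne {n : Fin d → ℤ} (hn : n ≠ 0) : coeff (constOne d) n = 0 := by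
  rw [coeff, (expBasis d).repr_apply_apply]
  exact (expBasis d).orthonormal.2 hn

lemma smoothing_constOne : smoothing d (constOne d) = constOne d := by
  refine ext_coeff fun n => ?_
  rw [coeff_smoothing]
  rcases eq_or_ne n 0 with rfl | hn
  · rw [weight_zero, Complex.ofReal_one, one_mul]
  · rw [coeff_constOne_of_ne hn, mul_zero]

lemma shiftGradOp_constOne (η : EuclideanSpace ℝ (Fin d)) (j : Fin d) :
    shiftGradOp η j (constOne d) = (Complex.I * (η j : ℂ)) • constOne d := by
  refine ext_coeff fun n => ?_
  rw [coeff_shiftGradOp, coeff_smul]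
  rcases eq_or_ne n 0 with rfl | hn
  · simp [weight_zero]
  · simp [coeff_constOne_of_ne hn]

lemma shiftLapOp_constOne (η : EuclideanSpace ℝ (Fin d)) :
    shiftLapOp η (constOne d) = (-(‖η‖ ^ 2 : ℝ) : ℂ) • constOne d := by
  refine ext_coeff fun n => ?_
  rw [coeff_shiftLapOp, coeff_smul]
  rcases eq_or_ne n 0 with rfl | hn
  · rw [shiftSq_zero, weight_zero, Complex.ofReal_one, mul_one]
  · rw [coeff_constOne_of_ne hn, mul_zero, mul_zero]

lemma analyticAt_shiftGradOp (j : Fin d) (η : EuclideanSpace ℝ (Fin d)) :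
    AnalyticAt ℝ (fun η => shiftGradOp η j) η :=
  analyticAt_const.add ((analyticAt_const.mul ((Complex.ofRealCLM.comp
    (EuclideanSpace.proj j)).analyticAt η)).smul analyticAt_const)

lemma analyticAt_shiftLapOp (η : EuclideanSpace ℝ (Fin d)) : AnalyticAt ℝ shiftLapOp η := by
  have hcoord (j : Fin d) : AnalyticAt ℝ (fun η : EuclideanSpace ℝ (Fin d) => (η j : ℂ)) η :=
    (Complex.ofRealCLM.comp (EuclideanSpace.proj j)).analyticAt η
  exact Finset.analyticAt_fun_sum _ fun j _ => (analyticAt_const.add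
    ((analyticAt_const.mul (hcoord j)).smul analyticAt_const)).sub
      (((hcoord j).pow 2).smul analyticAt_const)

end Fourier

section BlochOperator

lemma analyticAt_star {X E : Type*} [NormedAddCommGroup X] [NormedSpace ℝ X]
    [NormedAddCommGroup E] [InnerProductSpace ℂ E] [CompleteSpace E] {T : X → E →L[ℂ] E} {x : X}
    (hT : AnalyticAt ℝ T x) : AnalyticAt ℝ (fun y => star (T y)) x :=
  ((starL' ℝ : (E →L[ℂ] E) ≃L[ℝ] _).analyticAt _).comp hT

/-- A matrix `a` of operators is Hermitian (`a_jk* = a_kj`) and bounded below by `α`. -/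
structure IsElliptic {ι E : Type*} [Fintype ι] [NormedAddCommGroup E] [InnerProductSpace ℂ E]
    (a : ι → ι → E →L[ℂ] E) (α : ℝ) : Prop where
  symm : ∀ j k u v, ⟪a j k u, v⟫_ℂ = ⟪u, a k j v⟫_ℂ
  coercive : ∀ W : ι → E, α * ∑ j, ‖W j‖ ^ 2 ≤ (∑ j, ∑ k, ⟪W j, a j k (W k)⟫_ℂ).re

variable {d : ℕ} {a : Fin d → Fin d → L2Per d →L[ℂ] L2Per d} {α ρ l : ℝ}
  {η : EuclideanSpace ℝ (Fin d)}

/-- The operator `(1 - Δ)⁻¹ (ρ² (∇+iη)⁴ - (∇+iη) · a (∇+iη)) (1 - Δ)⁻¹` on `L²_♯`, which is bounded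
because its two outer factors absorb the four derivatives. -/
noncomputable def blochOp (a : Fin d → Fin d → L2Per d →L[ℂ] L2Per d) (ρ : ℝ)
    (η : EuclideanSpace ℝ (Fin d)) : L2Per d →L[ℂ] L2Per d :=
  ∑ j, ∑ k, star (shiftGradOp η j) * (a j k * shiftGradOp η k) +
    (ρ : ℂ) ^ 2 • (star (shiftLapOp η) * shiftLapOp η)

/-- The operator `(1 - Δ)⁻²` on `L²_♯`, which takes the place of the identity when a problem on
`H²_♯` is conjugated with `(1 - Δ)⁻¹`. -/
noncomputable def massOp (d : ℕ) : L2Per d →L[ℂ] L2Per d := smoothing d * smoothing d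

/-- A lower bound, for `|η| ≤ 1/2`, for the symbol `α |n + η|² + ρ² |n + η|⁴` at the nonzero
frequencies. -/
noncomputable def symbolGap (α ρ : ℝ) : ℝ := α / 4 + ρ ^ 2 / 16

lemma inner_blochOp (f g : L2Per d) : ⟪g, blochOp a ρ η f⟫_ℂ =
    ∑ j, ∑ k, ⟪shiftGradOp η j g, a j k (shiftGradOp η k f)⟫_ℂ +
      (ρ : ℂ) ^ 2 * ⟪shiftLapOp η g, shiftLapOp η f⟫_ℂ := by
  simp only [blochOp, ContinuousLinearMap.star_eq_adjoint, add_apply, sum_apply, smul_apply,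
    mul_apply_eq_comp, inner_add_right, inner_sum, inner_smul_right,
    ContinuousLinearMap.adjoint_inner_right]

lemma re_inner_blochOp (f : L2Per d) : (⟪blochOp a ρ η f, f⟫_ℂ).re =
    (∑ j, ∑ k, ⟪shiftGradOp η j f, a j k (shiftGradOp η k f)⟫_ℂ).re +
      ρ ^ 2 * ‖shiftLapOp η f‖ ^ 2 := by
  rw [← inner_conj_symm, Complex.conj_re, inner_blochOp, Complex.add_re,
    ← Complex.ofReal_pow, Complex.re_ofReal_mul]
  exact congrArg (_ + ρ ^ 2 * ·) (inner_self_eq_norm_sq (𝕜 := ℂ) _)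

lemma blochOp_symm (ha : IsElliptic a α) (f g : L2Per d) :
    ⟪blochOp a ρ η f, g⟫_ℂ = ⟪f, blochOp a ρ η g⟫_ℂ := by
  rw [← inner_conj_symm, inner_blochOp, inner_blochOp, map_add, map_sum, Finset.sum_comm]
  simp only [map_sum, map_mul, inner_conj_symm, ha.symm, map_pow, Complex.conj_ofReal]

lemma re_inner_blochOp_ge (ha : IsElliptic a α) (f : L2Per d) :
    α * ∑ j, ‖shiftGradOp η j f‖ ^ 2 + ρ ^ 2 * ‖shiftLapOp η f‖ ^ 2
      ≤ (⟪blochOp a ρ η f, f⟫_ℂ).re := by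
  rw [re_inner_blochOp]
  gcongr
  exact ha.coercive _

lemma analyticAt_blochOp : AnalyticAt ℝ (blochOp a ρ) η :=
  (Finset.analyticAt_fun_sum _ fun j _ => Finset.analyticAt_fun_sum _ fun k _ =>
    (analyticAt_star (analyticAt_shiftGradOp j η)).mul
      (analyticAt_const.mul (analyticAt_shiftGradOp k η))).add
    ((analyticAt_const (v := (ρ : ℂ) ^ 2)).smul
      ((analyticAt_star (analyticAt_shiftLapOp η)).mul (analyticAt_shiftLapOp η)))

lemma massOp_symm (u v : L2Per d) : ⟪massOp d u, v⟫_ℂ = ⟪u, massOp d v⟫_ℂ := by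
  rw [massOp, mul_apply_eq_comp, mul_apply_eq_comp, smoothing_symm, smoothing_symm]

lemma inner_massOp (f g : L2Per d) : ⟪massOp d f, g⟫_ℂ = ⟪smoothing d f, smoothing d g⟫_ℂ := by
  rw [massOp, mul_apply_eq_comp, smoothing_symm]

lemma re_inner_massOp (f : L2Per d) : (⟪massOp d f, f⟫_ℂ).re = ‖smoothing d f‖ ^ 2 := by
  rw [inner_massOp]
  exact inner_self_eq_norm_sq (𝕜 := ℂ) _

lemma re_inner_pencil_massOp (T : L2Per d →L[ℂ] L2Per d) (f : L2Per d) :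
    (⟪pencil T (massOp d) l f, f⟫_ℂ).re = (⟪T f, f⟫_ℂ).re - l * ‖smoothing d f‖ ^ 2 := by
  rw [pencil_apply, inner_sub_left, inner_smul_left, Complex.sub_re, Complex.conj_ofReal,
    Complex.re_ofReal_mul, re_inner_massOp]

lemma hasSum_symbol (α ρ l : ℝ) (η : EuclideanSpace ℝ (Fin d)) (f : L2Per d) :
    HasSum (fun n => (α * shiftSq η n + ρ ^ 2 * shiftSq η n ^ 2 - l) *
        ‖coeff (smoothing d f) n‖ ^ 2)
      (α * ∑ j, ‖shiftGradOp η j f‖ ^ 2 + ρ ^ 2 * ‖shiftLapOp η f‖ ^ 2 -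
        l * ‖smoothing d f‖ ^ 2) := by
  have hgrad : HasSum (fun n => shiftSq η n * ‖coeff (smoothing d f) n‖ ^ 2)
      (∑ j, ‖shiftGradOp η j f‖ ^ 2) := by
    simp only [← sum_sq_coeff_shiftGradOp]
    exact hasSum_sum fun j _ => hasSum_sq_coeff (shiftGradOp η j f)
  have hlap : HasSum (fun n => shiftSq η n ^ 2 * ‖coeff (smoothing d f) n‖ ^ 2)
      (‖shiftLapOp η f‖ ^ 2) := by
    simpa only [sq_coeff_shiftLapOp] using hasSum_sq_coeff (shiftLapOp η f)
  simpa only [← mul_assoc, ← add_mul, ← sub_mul] using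
    ((hgrad.mul_left α).add (hlap.mul_left (ρ ^ 2))).sub
      ((hasSum_sq_coeff (smoothing d f)).mul_left l)

lemma exists_mul_le_sub {l μ : ℝ} (hμ : 0 < μ) (hl : l < μ) :
    ∃ θ > 0, ∀ m ≥ μ, θ * m ≤ m - l := by
  rcases le_total l 0 with hl0 | hl0
  · exact ⟨1, one_pos, fun m _ => by linarith⟩
  · refine ⟨1 - l / μ, sub_pos.2 ((div_lt_one hμ).2 hl), fun m hm => ?_⟩
    have hlm : l ≤ l / μ * m := by
      rw [div_mul_eq_mul_div, le_div_iff₀ hμ]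
      gcongr
    linarith

lemma symbolGap_pos (hα : 0 < α) : 0 < symbolGap α ρ := by
  unfold symbolGap
  positivity

lemma symbolGap_le {s : ℝ} (hα : 0 < α) (hs : 1 / 4 ≤ s) :
    symbolGap α ρ ≤ α * s + ρ ^ 2 * s ^ 2 := by
  have hsq : (1 / 4) ^ 2 ≤ s ^ 2 := by gcongr
  unfold symbolGap
  nlinarith [sq_nonneg ρ]

lemma le_symbol_mul_weight_sq (hα : 0 < α) (hη : ‖η‖ ≤ 1 / 2) {n : Fin d → ℤ} (hn : n ≠ 0) :
    ρ ^ 2 / 64 ≤ (α * shiftSq η n + ρ ^ 2 * shiftSq η n ^ 2) * weight n ^ 2 := by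
  have hshift := freqSq_div_four_le_shiftSq hη hn
  have hweighted : 1 / 8 ≤ shiftSq η n * weight n := by
    rw [weight, ← div_eq_mul_inv, le_div_iff₀ (by linarith [freqSq_nonneg n])]
    linarith [one_le_freqSq hn]
  have hsq : (1 / 8) ^ 2 ≤ (shiftSq η n * weight n) ^ 2 := by gcongr
  have hfirst : 0 ≤ α * shiftSq η n * weight n ^ 2 := by
    have := shiftSq_nonneg η n
    positivity
  nlinarith [sq_nonneg ρ]

lemma exists_le_symbol (hα : 0 < α) (hρ : 0 < ρ) (hη : ‖η‖ ≤ 1 / 2) (hl : l < symbolGap α ρ) :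
    ∃ c > 0, ∀ n : Fin d → ℤ,
      c ≤ (α * shiftSq η n + ρ ^ 2 * shiftSq η n ^ 2 - l) * weight n ^ 2 +
        if n = 0 then symbolGap α ρ else 0 := by
  obtain ⟨θ, hθ, hθ_le⟩ := exists_mul_le_sub (symbolGap_pos hα) hl
  refine ⟨min (symbolGap α ρ - l) (θ * (ρ ^ 2 / 64)), lt_min (sub_pos.2 hl) (by positivity),
    fun n => ?_⟩
  rcases eq_or_ne n 0 with rfl | hn
  · refine (min_le_left _ _).trans ?_
    have hsymbol : 0 ≤ α * shiftSq η 0 + ρ ^ 2 * shiftSq η 0 ^ 2 := by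
      have := shiftSq_nonneg η 0
      positivity
    rw [if_pos rfl, weight_zero]
    linarith
  · have hquarter : 1 / 4 ≤ shiftSq η n := by
      linarith [freqSq_div_four_le_shiftSq hη hn, one_le_freqSq hn]
    rw [if_neg hn, add_zero]
    calc _ ≤ θ * (ρ ^ 2 / 64) := min_le_right _ _
      _ ≤ θ * ((α * shiftSq η n + ρ ^ 2 * shiftSq η n ^ 2) * weight n ^ 2) := by
        gcongr
        exact le_symbol_mul_weight_sq hα hη hn
      _ = θ * (α * shiftSq η n + ρ ^ 2 * shiftSq η n ^ 2) * weight n ^ 2 := by ring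
      _ ≤ _ := by
        gcongr
        exact hθ_le _ (symbolGap_le hα hquarter)

lemma coercive_pencil_blochOp (ha : IsElliptic a α) (hα : 0 < α) (hρ : 0 < ρ) (hη : ‖η‖ ≤ 1 / 2)
    (hl : l < symbolGap α ρ) :
    ∃ c > 0, ∀ f, c * ‖f‖ ^ 2 ≤ (⟪pencil (blochOp a ρ η) (massOp d) l f, f⟫_ℂ).re +
      symbolGap α ρ * ‖coeff f 0‖ ^ 2 := by
  obtain ⟨c, hc, hsymbol⟩ := exists_le_symbol hα hρ hη hl
  refine ⟨c, hc, fun f => ?_⟩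
  have hsum := (hasSum_symbol α ρ l η f).add
    (hasSum_ite_eq (0 : Fin d → ℤ) (symbolGap α ρ * ‖coeff f 0‖ ^ 2))
  have hle := hasSum_le (fun n => ?_) ((hasSum_sq_coeff f).mul_left c) hsum
  · rw [re_inner_pencil_massOp]
    linarith [re_inner_blochOp_ge (ρ := ρ) (η := η) ha f]
  · refine (mul_le_mul_of_nonneg_right (hsymbol n) (sq_nonneg _)).trans_eq ?_
    rw [coeff_smoothing, norm_mul, mul_pow, Complex.norm_real, Real.norm_eq_abs, sq_abs, add_mul,
      ite_mul, zero_mul, mul_assoc]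
    congr 1
    exact ite_congr rfl (fun hn => by rw [hn]) fun _ => rfl

lemma re_inner_blochOp_constOne_lt (hη : ‖η‖ ≤ 1 / 2)
    (hsmall : (∑ j, ∑ k, ⟪shiftGradOp η j (constOne d),
      a j k (shiftGradOp η k (constOne d))⟫_ℂ).re < α / 4) :
    (⟪blochOp a ρ η (constOne d), constOne d⟫_ℂ).re < symbolGap α ρ := by
  rw [re_inner_blochOp, symbolGap, shiftLapOp_constOne, norm_smul, norm_constOne, norm_neg,
    Complex.norm_real, mul_one, norm_pow, norm_norm]
  have hfourth : (‖η‖ ^ 2) ^ 2 ≤ ((1 / 2) ^ 2) ^ 2 := by gcongr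
  nlinarith [sq_nonneg ρ]

lemma eventually_re_inner_shiftGradOp_constOne_lt (a : Fin d → Fin d → L2Per d →L[ℂ] L2Per d)
    {ε : ℝ} (hε : 0 < ε) :
    ∀ᶠ η in 𝓝 0, (∑ j, ∑ k, ⟪shiftGradOp η j (constOne d),
      a j k (shiftGradOp η k (constOne d))⟫_ℂ).re < ε := by
  simp only [shiftGradOp_constOne]
  have hcont : Continuous fun η : EuclideanSpace ℝ (Fin d) =>
      (∑ j, ∑ k, ⟪(Complex.I * (η j : ℂ)) • constOne d,
        a j k ((Complex.I * (η k : ℂ)) • constOne d)⟫_ℂ).re := by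
    fun_prop
  exact hcont.continuousAt.eventually_lt continuousAt_const (by simpa using hε)

lemma rankOneGap_blochOp (ha : IsElliptic a α) (hα : 0 < α) (hρ : 0 < ρ) (hη : ‖η‖ ≤ 1 / 2)
    (hlt : (⟪blochOp a ρ η (constOne d), constOne d⟫_ℂ).re < symbolGap α ρ) :
    RankOneGap (blochOp a ρ η) (massOp d) ((√(symbolGap α ρ) : ℂ) • constOne d)
      (symbolGap α ρ) where
  left_symm := blochOp_symm ha
  right_symm := massOp_symm
  right_pos f hf := by
    have hne : smoothing d f ≠ 0 := (map_ne_zero_iff _ smoothing_injective).2 hf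
    rw [re_inner_massOp]
    positivity
  coercive l hl := by
    obtain ⟨c, hc, hle⟩ := coercive_pencil_blochOp ha hα hρ hη hl
    refine ⟨c, hc, fun f => (hle f).trans_eq ?_⟩
    rw [inner_smul_left, inner_constOne, Complex.conj_ofReal, norm_mul, Complex.norm_real, mul_pow,
      Real.norm_eq_abs, sq_abs, Real.sq_sqrt (symbolGap_pos hα).le]
  exists_nonneg := by
    refine ⟨0, symbolGap_pos hα, fun f => ?_⟩
    rw [re_inner_pencil_massOp, zero_mul, sub_zero]
    exact le_trans (by positivity) (re_inner_blochOp_ge ha f)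
  exists_nonpos := by
    refine ⟨_, hlt, constOne d, norm_ne_zero_iff.1 (by simp [norm_constOne]), ?_⟩
    rw [re_inner_pencil_massOp, smoothing_constOne, norm_constOne, one_pow, mul_one, sub_self]

theorem exists_ball_rankOneGap_blochOp (ha : IsElliptic a α) (hα : 0 < α) :
    ∃ δ > 0, ∀ ρ > 0, ∀ η ∈ Metric.ball (0 : EuclideanSpace ℝ (Fin d)) δ,
      RankOneGap (blochOp a ρ η) (massOp d) ((√(symbolGap α ρ) : ℂ) • constOne d)
        (symbolGap α ρ) := by
  have hsmall := (eventually_re_inner_shiftGradOp_constOne_lt a (show 0 < α / 4 by positivity)).and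
    (Metric.closedBall_mem_nhds (0 : EuclideanSpace ℝ (Fin d)) one_half_pos)
  obtain ⟨δ, hδ, hball⟩ := Metric.eventually_nhds_iff_ball.1 hsmall
  refine ⟨δ, hδ, fun ρ hρ η hη => ?_⟩
  have hhalf : ‖η‖ ≤ 1 / 2 := mem_closedBall_zero_iff.1 (hball η hη).2
  exact rankOneGap_blochOp ha hα hρ hhalf (re_inner_blochOp_constOne_lt hhalf (hball η hη).1)

end BlochOperator

section Multiplication

open MeasureTheory

variable {X : Type*} {mX : MeasurableSpace X} {ν : Measure X} {g : X → ℂ}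

/-- The operator on `L²(ν)` of multiplication by an essentially bounded function `g`. -/
noncomputable def mulOp (hg : MemLp g ∞ ν) : Lp ℂ 2 ν →L[ℂ] Lp ℂ 2 ν :=
  (ContinuousLinearMap.mul ℂ ℂ).holderL ν ∞ 2 2 hg.toLp

lemma coeFn_mulOp (hg : MemLp g ∞ ν) (u : Lp ℂ 2 ν) : mulOp hg u =ᵐ[ν] fun x => g x * u x := by
  filter_upwards [(ContinuousLinearMap.mul ℂ ℂ).coeFn_holder (r := 2) hg.toLp u, hg.coeFn_toLp]
    with x hholder hcoe
  rw [← hcoe]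
  exact hholder

lemma inner_mulOp_ae_eq (hg : MemLp g ∞ ν) (u v : Lp ℂ 2 ν) :
    (fun x => ⟪v x, mulOp hg u x⟫_ℂ) =ᵐ[ν] fun x => g x * u x * (starRingEnd ℂ) (v x) := by
  filter_upwards [coeFn_mulOp hg u] with x hx
  rw [RCLike.inner_apply, hx]

lemma integrable_mul_mul_conj (hg : MemLp g ∞ ν) (u v : Lp ℂ 2 ν) :
    Integrable (fun x => g x * u x * (starRingEnd ℂ) (v x)) ν :=
  (L2.integrable_inner (𝕜 := ℂ) v (mulOp hg u)).congr (inner_mulOp_ae_eq hg u v)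

lemma inner_mulOp (hg : MemLp g ∞ ν) (u v : Lp ℂ 2 ν) :
    ⟪v, mulOp hg u⟫_ℂ = ∫ x, g x * u x * (starRingEnd ℂ) (v x) ∂ν :=
  (L2.inner_def _ _).trans (integral_congr_ae (inner_mulOp_ae_eq hg u v))

lemma integrable_norm_sq (u : Lp ℂ 2 ν) : Integrable (fun x => ‖u x‖ ^ 2) ν :=
  (memLp_two_iff_integrable_sq_norm (Lp.aestronglyMeasurable u)).1 (Lp.memLp u)

lemma norm_sq_eq_integral (u : Lp ℂ 2 ν) : ‖u‖ ^ 2 = ∫ x, ‖u x‖ ^ 2 ∂ν := by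
  rw [← inner_self_eq_norm_sq (𝕜 := ℂ), L2.inner_def, ← integral_re (L2.integrable_inner u u)]
  simp only [inner_self_eq_norm_sq]

variable {ι : Type*} [Fintype ι]

lemma integrable_sum_mul_mul_conj {b : ι → ι → X → ℂ} (hb : ∀ j k, MemLp (b j k) ∞ ν)
    (V W : ι → Lp ℂ 2 ν) :
    Integrable (fun x => ∑ j, ∑ k, b j k x * V k x * (starRingEnd ℂ) (W j x)) ν :=
  integrable_finsetSum _ fun j _ => integrable_finsetSum _ fun k _ =>
    integrable_mul_mul_conj (hb j k) (V k) (W j)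

lemma sum_inner_mulOp {b : ι → ι → X → ℂ} (hb : ∀ j k, MemLp (b j k) ∞ ν) (V W : ι → Lp ℂ 2 ν) :
    ∑ j, ∑ k, ⟪W j, mulOp (hb j k) (V k)⟫_ℂ =
      ∫ x, ∑ j, ∑ k, b j k x * V k x * (starRingEnd ℂ) (W j x) ∂ν := by
  have hint (j k : ι) := integrable_mul_mul_conj (hb j k) (V k) (W j)
  rw [integral_finsetSum _ fun j _ => integrable_finsetSum _ fun k _ => hint j k]
  refine Finset.sum_congr rfl fun j _ => ?_
  rw [integral_finsetSum _ fun k _ => hint j k]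
  exact Finset.sum_congr rfl fun k _ => inner_mulOp (hb j k) _ _

lemma mulOp_ofReal_symm {r s : X → ℝ} (hr : MemLp (fun x => (r x : ℂ)) ∞ ν)
    (hs : MemLp (fun x => (s x : ℂ)) ∞ ν) (hrs : r =ᵐ[ν] s) (u v : Lp ℂ 2 ν) :
    ⟪mulOp hr u, v⟫_ℂ = ⟪u, mulOp hs v⟫_ℂ := by
  rw [← inner_conj_symm, inner_mulOp, inner_mulOp, ← integral_conj]
  refine integral_congr_ae ?_
  filter_upwards [hrs] with x hx
  rw [map_mul, map_mul, Complex.conj_ofReal, Complex.conj_conj, hx]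
  ring

lemma le_re_sum_mul_conj {B : Matrix ι ι ℝ} {α : ℝ}
    (hB : ∀ ξ : ι → ℝ, α * (ξ ⬝ᵥ ξ) ≤ B.mulVec ξ ⬝ᵥ ξ) (z : ι → ℂ) :
    α * ∑ j, ‖z j‖ ^ 2 ≤ (∑ j, ∑ k, (B j k : ℂ) * z k * (starRingEnd ℂ) (z j)).re := by
  have hre_im := add_le_add (hB fun j => (z j).re) (hB fun j => (z j).im)
  simp only [dotProduct, Matrix.mulVec, ← mul_add, Finset.sum_mul, ← Finset.sum_add_distrib]
    at hre_im
  simp only [Complex.sq_norm, Complex.normSq_apply, Complex.re_sum]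
  refine hre_im.trans_eq (Finset.sum_congr rfl fun j _ => Finset.sum_congr rfl fun k _ => ?_)
  simp

lemma isElliptic_mulOp {B : X → Matrix ι ι ℝ} {α : ℝ}
    (hB : ∀ j k, MemLp (fun x => (B x j k : ℂ)) ∞ ν) (hsymm : ∀ᵐ x ∂ν, (B x).IsSymm)
    (hell : ∀ᵐ x ∂ν, ∀ ξ : ι → ℝ, α * (ξ ⬝ᵥ ξ) ≤ (B x).mulVec ξ ⬝ᵥ ξ) :
    IsElliptic (fun j k => mulOp (hB j k)) α where
  symm j k := mulOp_ofReal_symm _ _ (hsymm.mono fun x hx => hx.apply k j)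
  coercive W := by
    have hint := integrable_sum_mul_mul_conj hB W W
    have hnorm : Integrable (fun x => ∑ j, ‖W j x‖ ^ 2) ν :=
      integrable_finsetSum _ fun j _ => integrable_norm_sq (W j)
    calc α * ∑ j, ‖W j‖ ^ 2 = ∫ x, α * ∑ j, ‖W j x‖ ^ 2 ∂ν := by
          simp only [norm_sq_eq_integral]
          rw [integral_const_mul, integral_finsetSum _ fun j _ => integrable_norm_sq (W j)]
      _ ≤ ∫ x, (∑ j, ∑ k, (B x j k : ℂ) * W k x * (starRingEnd ℂ) (W j x)).re ∂ν :=
          integral_mono_ae (hnorm.const_mul α) hint.re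
            (hell.mono fun x hx => le_re_sum_mul_conj hx _)
      _ = _ := by
          rw [sum_inner_mulOp]
          exact integral_re hint

end Multiplication

section Cell

open MeasureTheory

variable {d : ℕ}

lemma measurePreserving_equivIco_coe :
    MeasurePreserving (fun x : UnitAddCircle => (AddCircle.equivIco (1 : ℝ) 0 x : ℝ))
      AddCircle.haarAddCircle (volume.restrict (Set.Ico 0 1)) := by
  have hmeas : Measurable fun x : UnitAddCircle => (AddCircle.equivIco (1 : ℝ) 0 x : ℝ) :=
    measurable_subtype_coe.comp (AddCircle.measurableEquivIco 1 0).measurable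
  have hvolume : (AddCircle.haarAddCircle : Measure UnitAddCircle) = volume := by
    rw [AddCircle.volume_eq_smul_haarAddCircle, ENNReal.ofReal_one, one_smul]
  have hmap := (AddCircle.measurePreserving_mk (1 : ℝ) 0).map_eq
  rw [zero_add, ← Measure.restrict_congr_set Ico_ae_eq_Ioc] at hmap
  refine ⟨hmeas, ?_⟩
  rw [hvolume, ← hmap, Measure.map_map hmeas AddCircle.measurable_mk']
  refine (Measure.map_congr ?_).trans Measure.map_id
  filter_upwards [ae_restrict_mem measurableSet_Ico] with t ht
  rw [← zero_add (1 : ℝ)] at ht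
  exact congrArg Subtype.val (AddCircle.equivIco_coe_eq ht)

lemma quasiMeasurePreserving_cellPoint :
    Measure.QuasiMeasurePreserving (cellPoint (d := d)) (torusMeasure d) volume := by
  have hunit := measurePreserving_pi (fun _ : Fin d => AddCircle.haarAddCircle)
    (fun _ : Fin d => (volume : Measure ℝ).restrict (Set.Ico 0 1))
    fun _ => measurePreserving_equivIco_coe
  have hscale : Measure.QuasiMeasurePreserving (fun y : Fin d → ℝ => (2 * Real.pi) • y)
      (Measure.pi fun _ : Fin d => (volume : Measure ℝ).restrict (Set.Ico 0 1)) volume := by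
    refine ⟨measurable_const_smul _, Measure.AbsolutelyContinuous.mk fun s hs hnull => ?_⟩
    rw [Measure.map_apply (measurable_const_smul _) hs,
      ← Measure.restrict_pi_pi (fun _ : Fin d => (volume : Measure ℝ)) fun _ => Set.Ico 0 1]
    refine Measure.absolutelyContinuous_of_le Measure.restrict_le_self ?_
    change volume _ = 0
    rw [Measure.addHaar_preimage_smul _ (by positivity), hnull, mul_zero]
  exact hscale.comp hunit.quasiMeasurePreserving

lemma innerY_eq (u v : L2Per d) : innerY u v = ((2 * Real.pi) ^ d : ℝ) * ⟪v, u⟫_ℂ := by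
  rw [innerY, cellIntegral, L2.inner_def]
  rfl

variable {A : (Fin d → ℝ) → Matrix (Fin d) (Fin d) ℝ}
  (hA : ∀ j k, MemLp (fun x => (A (cellPoint x) j k : ℂ)) ∞ (torusMeasure d))
  (ρ : ℝ) (η : EuclideanSpace ℝ (Fin d))

lemma blochForm_smoothing (f g : L2Per d) :
    blochForm A ρ η (smoothing d f) (smoothing d g) =
      ((2 * Real.pi) ^ d : ℝ) * ⟪g, blochOp (fun j k => mulOp (hA j k)) ρ η f⟫_ℂ := by
  have hlap := innerY_eq (shiftLapOp η f) (shiftLapOp η g)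
  rw [innerY] at hlap
  simp only [blochForm, shiftD_smoothing, shiftLap_smoothing, hlap]
  rw [cellIntegral, inner_blochOp, sum_inner_mulOp]
  ring

lemma weak_equation_smoothing_iff (l : ℝ) (f g : L2Per d) :
    blochForm A ρ η (smoothing d f) (smoothing d g) =
        l * innerY (smoothing d f) (smoothing d g) ↔
      ⟪g, blochOp (fun j k => mulOp (hA j k)) ρ η f⟫_ℂ = ⟪g, (l : ℂ) • massOp d f⟫_ℂ := by
  have hvolume : (((2 * Real.pi) ^ d : ℝ) : ℂ) ≠ 0 :=
    Complex.ofReal_ne_zero.2 (by positivity)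
  rw [blochForm_smoothing hA, innerY_eq, mul_left_comm, mul_right_inj' hvolume, inner_smul_right,
    ← massOp_symm, inner_massOp]

lemma blochEigenvalues_eq : blochEigenvalues A ρ η =
    pencilEigenvalues (blochOp (fun j k => mulOp (hA j k)) ρ η) (massOp d) := by
  ext l
  constructor
  · rintro ⟨φ, hφ, hφ0, hweak⟩
    obtain ⟨f, rfl⟩ := memH2Per_iff.1 hφ
    refine ⟨f, (map_ne_zero_iff _ smoothing_injective).1 hφ0, ext_inner_left ℂ fun g => ?_⟩
    exact (weak_equation_smoothing_iff hA ρ η l f g).1 (hweak _ (memH2Per_iff.2 ⟨g, rfl⟩))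
  · rintro ⟨f, hf, heq⟩
    refine ⟨smoothing d f, memH2Per_iff.2 ⟨f, rfl⟩,
      (map_ne_zero_iff _ smoothing_injective).2 hf, fun v hv => ?_⟩
    obtain ⟨g, rfl⟩ := memH2Per_iff.1 hv
    exact (weak_equation_smoothing_iff hA ρ η l f g).2 (congrArg _ heq)

end Cell

end BlochWave

open BlochWave MeasureTheory

theorem theorem4p4_general (d : ℕ) (A : (Fin d → ℝ) → Matrix (Fin d) (Fin d) ℝ)
    (hmeas : ∀ j k, AEStronglyMeasurable (fun x => A (cellPoint x) j k) (torusMeasure d))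
    (hbdd : ∃ M : ℝ, ∀ᵐ x ∂torusMeasure d, ∀ j k, |A (cellPoint x) j k| ≤ M)
    (hell : ∃ α : ℝ, 0 < α ∧ ∀ᵐ x ∂torusMeasure d, ∀ ξ : Fin d → ℝ,
      α * (ξ ⬝ᵥ ξ) ≤ (A (cellPoint x)).mulVec ξ ⬝ᵥ ξ)
    (hsymm : ∀ᵐ x ∂torusMeasure d, (A (cellPoint x)).IsSymm) :
    ∃ δ : ℝ, 0 < δ ∧ ∀ ρ : ℝ, 0 < ρ →
      (∀ η ∈ Metric.ball (0 : EuclideanSpace ℝ (Fin d)) δ,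
        IsLeast (blochEigenvalues A ρ η) (firstBlochEigenvalue A ρ η)) ∧
      AnalyticOnNhd ℝ (firstBlochEigenvalue A ρ)
        (Metric.ball (0 : EuclideanSpace ℝ (Fin d)) δ) := by
  obtain ⟨M, hM⟩ := hbdd
  obtain ⟨α, hα, hell⟩ := hell
  have hA (j k : Fin d) : MemLp (fun x => (A (cellPoint x) j k : ℂ)) ⊤ (torusMeasure d) :=
    (memLp_top_of_bound (hmeas j k) M (hM.mono fun x hx => hx j k)).ofReal
  obtain ⟨δ, hδ, hgap⟩ := exists_ball_rankOneGap_blochOp (isElliptic_mulOp hA hsymm hell) hα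
  refine ⟨δ, hδ, fun ρ hρ => ?_⟩
  simp only [funext (firstBlochEigenvalue.eq_def A ρ), blochEigenvalues_eq hA]
  exact ⟨fun η hη => (hgap ρ hρ η hη).isLeast_sInf, RankOneGap.analyticOnNhd_sInf
    (fun _ _ => analyticAt_blochOp) Metric.isOpen_ball (hgap ρ hρ)⟩

theorem theorem4p4 (d : ℕ) (A : (Fin d → ℝ) → Matrix (Fin d) (Fin d) ℝ)
    (hmeas : ∀ j k, Measurable fun y => A y j k)
    (hbdd : ∃ M : ℝ, ∀ᵐ y, ∀ j k, |A y j k| ≤ M)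
    (hell : ∃ α : ℝ, 0 < α ∧ ∀ᵐ y, ∀ ξ : Fin d → ℝ, α * (ξ ⬝ᵥ ξ) ≤ (A y).mulVec ξ ⬝ᵥ ξ)
    (hper : ∀ p : Fin d → ℤ, ∀ᵐ y : Fin d → ℝ, A (fun j => y j + 2 * Real.pi * p j) = A y)
    (hsymm : ∀ᵐ y, (A y).IsSymm) :
    ∃ δ : ℝ, 0 < δ ∧ ∀ ρ : ℝ, 0 < ρ →
      (∀ η ∈ Metric.ball (0 : EuclideanSpace ℝ (Fin d)) δ,
        IsLeast (BlochWave.blochEigenvalues A ρ η) (BlochWave.firstBlochEigenvalue A ρ η)) ∧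
      AnalyticOnNhd ℝ (BlochWave.firstBlochEigenvalue A ρ)
        (Metric.ball (0 : EuclideanSpace ℝ (Fin d)) δ) :=
  have hq := quasiMeasurePreserving_cellPoint (d := d)
  theorem4p4_general d A (fun j k => ((hmeas j k).comp hq.measurable).aestronglyMeasurable)
    (hbdd.imp fun _ hM => hq.ae hM) (hell.imp fun _ hα => ⟨hα.1, hq.ae hα.2⟩) (hq.ae hsymm)
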